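/- Let $m \ge 2$ be an integer, and let $c_{m,0}$ denote the unique root in $(0,1)$ of $k^m + k^{m-1} - 1$ (which exists). Let $\delta > 0$, let $f$ be a real function that is $C^{m+1}$ on $[-\delta,\delta]$, and let $0$ be an $m$-fold root of $f$, i.e. $f^{(j)}(0) = 0$ for $0 \le j \le m-1$ and $f^{(m)}(0) \ne 0$. For initial values $e_0$ and $e_1 = k_0 e_0$, consider the secant iterates (which are also the errors with respect to the root $0$) $$e_{n+1} = e_n - f(e_n)\,\frac{e_{n-1} - e_n}{f(e_{n-1}) - f(e_n)}, \qquad n \ge 1 .$$ There is $\eta > 0$, depending only on $f$, $m$ and $\delta$, such that for every $k_0 \in (0,1) \cup (1,\infty)$ and every $e_0 > 0$ so small that $\max(e_0, k_0 e_0) < \eta$, the following hold. The iteration is well defined, with $e_n \in (0,\delta]$ and $f(e_n) \ne f(e_{n+1})$ for all $n \ge 0$. The sequence $(e_n)$ converges Q-linearly to $0$ with asymptotic error constant $c_{m,0}$, i.e. $e_n \to 0$ and $$\lim_{n\to\infty} \frac{|e_{n+1}|}{|e_n|} = c_{m,0} \in (0,1),$$ and moreover $k_n := e_{n+1}/e_n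 \to c_{m,0}$. -/

import Mathlib

open Filter Topology Set

/-- The secant iteration for `f` with initial values `x₀`, `x₁`:
`x_{n+1} = x_n - f(x_n) (x_{n-1} - x_n) / (f(x_{n-1}) - f(x_n))`.
A step is meaningful only when `f(x_{n-1}) ≠ f(x_n)`. -/
noncomputable def secantSeq (f : ℝ → ℝ) (x₀ x₁ : ℝ) : ℕ → ℝ
  | 0 => x₀
  | 1 => x₁
  | n + 2 =>
      secantSeq f x₀ x₁ (n + 1) -
        f (secantSeq f x₀ x₁ (n + 1)) *
          ((secantSeq f x₀ x₁ n - secantSeq f x₀ x₁ (n + 1)) /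
            (f (secantSeq f x₀ x₁ n) - f (secantSeq f x₀ x₁ (n + 1))))

/-- `a` is an `m`-fold root of `f`: the derivatives of order `< m` vanish at `a`,
and the derivative of order `m` does not. -/
def IsMultipleRoot (f : ℝ → ℝ) (a : ℝ) (m : ℕ) : Prop :=
  (∀ j < m, iteratedDeriv j f a = 0) ∧ iteratedDeriv m f a ≠ 0

/-- `x` converges to `L` with Q-order `p ≥ 1` and asymptotic error constant `c > 0`. -/
def ConvergesWithQOrder (x : ℕ → ℝ) (L p c : ℝ) : Prop :=
  Tendsto x atTop (𝓝 L) ∧ 1 ≤ p ∧ 0 < c ∧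
    Tendsto (fun n => |x (n + 1) - L| / |x n - L| ^ p) atTop (𝓝 c)

/-- Q-linear convergence of `x` to `L` with asymptotic error constant `c`:
Q-order `1` and `0 < c < 1`. -/
def ConvergesQLinearly (x : ℕ → ℝ) (L c : ℝ) : Prop :=
  ConvergesWithQOrder x L 1 c ∧ c < 1

/-- `c` is the unique root in `(0, 1)` of `k ^ m + k ^ (m - 1) - 1` (used for `m ≥ 2`). -/
def IsUniqueCharRoot (m : ℕ) (c : ℝ) : Prop :=
  (c ∈ Ioo (0 : ℝ) 1 ∧ c ^ m + c ^ (m - 1) - 1 = 0) ∧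
    ∀ k ∈ Ioo (0 : ℝ) 1, k ^ m + k ^ (m - 1) - 1 = 0 → k = c

/-! Write `m = n + 1` and let `φ` be `secantRatioMap n`. For `f = x ^ m` the ratios `k_j = e_{j+1} /
e_j` satisfy `k_{j+1} = φ (k_j)` exactly. For general `f`, `exists_secant_step` gives `k_{j+1} = ρ_j
* φ (k_j)`, with `ρ_j` near 1 as soon as both iterates are small, whatever their ratio; this
uniformity makes `η` independent of `k₀`. The same lemma makes each new iterate positive and smaller
than the two before it, so the errors decrease, and a positive limit is excluded because `φ 1 < 1`.
Hence `ρ_j → 1` and the ratios form an asymptotic orbit of `φ`. As `φ` is antitone while `k * φ k`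
is strictly increasing, such an orbit converges to a fixed point of `φ`
(`exists_tendsto_of_asymptotic_orbit`), which is the characteristic root. -/

/-! ### The ratio map of the pure power -/

open Finset in
/-- The map governing the ratios of secant iterates for `x ^ (n + 1)`. -/
noncomputable def secantRatioMap (n : ℕ) (k : ℝ) : ℝ :=
  (∑ i ∈ range n, k ^ i) / ∑ i ∈ range (n + 1), k ^ i

lemma one_le_geom_sum_succ (n : ℕ) {k : ℝ} (hk : 0 ≤ k) :
    1 ≤ ∑ i ∈ Finset.range (n + 1), k ^ i := by
  rw [Finset.sum_range_succ']
  have : 0 ≤ ∑ i ∈ Finset.range n, k ^ (i + 1) := Finset.sum_nonneg fun i _ => by positivity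
  simpa using this

lemma secantRatioMap_nonneg (n : ℕ) {k : ℝ} (hk : 0 ≤ k) : 0 ≤ secantRatioMap n k :=
  div_nonneg (Finset.sum_nonneg fun i _ => by positivity)
    (zero_le_one.trans (one_le_geom_sum_succ n hk))

lemma secantRatioMap_pos {n : ℕ} (hn : 1 ≤ n) {k : ℝ} (hk : 0 ≤ k) : 0 < secantRatioMap n k := by
  obtain ⟨p, rfl⟩ := Nat.exists_eq_add_of_le' hn
  exact div_pos (zero_lt_one.trans_le (one_le_geom_sum_succ p hk))
    (zero_lt_one.trans_le (one_le_geom_sum_succ _ hk))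

lemma secantRatioMap_le_one (n : ℕ) {k : ℝ} (hk : 0 ≤ k) : secantRatioMap n k ≤ 1 := by
  have h := one_le_geom_sum_succ n hk
  rw [secantRatioMap, div_le_one (zero_lt_one.trans_le h), Finset.sum_range_succ]
  have := pow_nonneg hk n
  linarith

/-- Multiplying the numerator by `k` gives the denominator minus 1; in this form the monotonicity of
`k * φ k` is visible. -/
lemma mul_secantRatioMap (n : ℕ) {k : ℝ} (hk : 0 ≤ k) :
    k * secantRatioMap n k = 1 - (∑ i ∈ Finset.range (n + 1), k ^ i)⁻¹ := by
  have h := zero_lt_one.trans_le (one_le_geom_sum_succ n hk)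
  have h' : ∑ i ∈ Finset.range (n + 1), k ^ i = k * (∑ i ∈ Finset.range n, k ^ i) + 1 :=
    geom_sum_succ
  rw [secantRatioMap, mul_div_assoc', inv_eq_one_div, eq_sub_iff_add_eq, ← add_div,
    ← h', div_self h.ne']

lemma strictMonoOn_mul_secantRatioMap {n : ℕ} (hn : 1 ≤ n) :
    StrictMonoOn (fun k : ℝ => k * secantRatioMap n k) (Ici 0) := by
  intro a ha b hb hab
  simp only [mul_secantRatioMap n (mem_Ici.1 ha), mul_secantRatioMap n (mem_Ici.1 hb)]
  have h := zero_lt_one.trans_le (one_le_geom_sum_succ n (mem_Ici.1 ha))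
  refine sub_lt_sub_left (inv_strictAnti₀ h ?_) 1
  refine Finset.sum_lt_sum (fun i _ => pow_le_pow_left₀ ha hab.le i)
    ⟨1, by simp; omega, by simpa using hab⟩

lemma antitoneOn_secantRatioMap (n : ℕ) : AntitoneOn (secantRatioMap n) (Ici 0) := by
  intro a ha b hb hab
  rw [mem_Ici] at ha hb
  have h1 := zero_lt_one.trans_le (one_le_geom_sum_succ n ha)
  have h2 := zero_lt_one.trans_le (one_le_geom_sum_succ n hb)
  -- After cross-multiplication the products of the two shorter sums cancel, leaving this termwise
  -- comparison.
  have h3 : (∑ i ∈ Finset.range n, b ^ i) * a ^ n ≤ (∑ i ∈ Finset.range n, a ^ i) * b ^ n := by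
    rw [Finset.sum_mul, Finset.sum_mul]
    refine Finset.sum_le_sum fun i hi => ?_
    obtain ⟨j, rfl⟩ := Nat.exists_eq_add_of_lt (Finset.mem_range.1 hi)
    have : a ^ (j + 1) ≤ b ^ (j + 1) := pow_le_pow_left₀ ha hab _
    calc b ^ i * a ^ (i + j + 1) = (a ^ i * b ^ i) * a ^ (j + 1) := by ring
      _ ≤ (a ^ i * b ^ i) * b ^ (j + 1) := by gcongr
      _ = _ := by ring
  rw [secantRatioMap, secantRatioMap, div_le_div_iff₀ h2 h1, Finset.sum_range_succ,
    Finset.sum_range_succ]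
  linarith

lemma continuousOn_secantRatioMap (n : ℕ) : ContinuousOn (secantRatioMap n) (Ici 0) := by
  unfold secantRatioMap
  refine ContinuousOn.div (by fun_prop) (by fun_prop) fun k hk => ?_
  exact (zero_lt_one.trans_le (one_le_geom_sum_succ n hk)).ne'

lemma secantRatioMap_one (n : ℕ) : secantRatioMap n 1 = n / (n + 1) := by
  simp [secantRatioMap]

lemma secantRatioMap_zero {n : ℕ} (hn : 1 ≤ n) : secantRatioMap n 0 = 1 := by
  obtain ⟨p, rfl⟩ := Nat.exists_eq_add_of_le' hn
  simp [secantRatioMap, Finset.sum_range_succ']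

/-! ### The characteristic root -/

lemma exists_isUniqueCharRoot {m : ℕ} (hm : 2 ≤ m) : ∃ c, IsUniqueCharRoot m c := by
  have hmono : StrictMonoOn (fun k : ℝ => k ^ m + k ^ (m - 1) - 1) (Ici 0) := by
    intro a ha b hb hab
    have h1 : a ^ m < b ^ m := pow_lt_pow_left₀ hab ha (by omega)
    have h2 : a ^ (m - 1) ≤ b ^ (m - 1) := pow_le_pow_left₀ ha hab.le _
    simp only
    linarith
  obtain ⟨c, hc, hc0⟩ : (0 : ℝ) ∈ (fun k : ℝ => k ^ m + k ^ (m - 1) - 1) '' Ioo 0 1 := by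
    apply intermediate_value_Ioo zero_le_one (by fun_prop)
    have h1 : m ≠ 0 := by omega
    have h2 : m - 1 ≠ 0 := by omega
    simp [h1, h2]
  refine ⟨c, ⟨hc, hc0⟩, fun k hk hk0 => ?_⟩
  exact hmono.injOn hk.1.le hc.1.le (hk0.trans hc0.symm)

lemma charRoot_of_fixedPoint {n : ℕ} (hn : 1 ≤ n) {k : ℝ} (hk : k ∈ Icc (0 : ℝ) 1)
    (hfix : secantRatioMap n k = k) :
    k ∈ Ioo (0 : ℝ) 1 ∧ k ^ (n + 1) + k ^ n - 1 = 0 := by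
  have hk0 : k ≠ 0 := by
    rintro rfl
    simp [secantRatioMap_zero hn] at hfix
  have hk1 : k ≠ 1 := by
    rintro rfl
    rw [secantRatioMap_one, div_eq_iff (by positivity)] at hfix
    linarith
  refine ⟨⟨lt_of_le_of_ne hk.1 hk0.symm, lt_of_le_of_ne hk.2 hk1⟩, ?_⟩
  have hS := zero_lt_one.trans_le (one_le_geom_sum_succ n hk.1)
  rw [secantRatioMap, div_eq_iff hS.ne'] at hfix
  have g1 := geom_sum_mul k n
  have g2 := geom_sum_mul k (n + 1)
  -- Multiplying by `k - 1` telescopes both geometric sums of the fixed-point equation.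
  have : (k - 1) * (k ^ (n + 1) + k ^ n - 1) = 0 := by
    rw [pow_succ] at *
    linear_combination g1 - k * g2 - (k - 1) * hfix
  exact (mul_eq_zero.1 this).resolve_left (sub_ne_zero.2 hk1)

/-! ### Convergence of asymptotic orbits -/

/-- Asymptotic orbits of an antitone map `φ` for which `k * φ k` is strictly increasing
converge. -/
lemma exists_tendsto_of_asymptotic_orbit {φ : ℝ → ℝ} (hanti : AntitoneOn φ (Ici 0))
    (hcont : ContinuousOn φ (Ici 0)) (hmono : StrictMonoOn (fun k => k * φ k) (Ici 0))
    {k : ℕ → ℝ} (hk : ∀ n, k n ∈ Icc (0 : ℝ) 1)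
    (hlim : Tendsto (fun n => k (n + 1) - φ (k n)) atTop (𝓝 0)) :
    ∃ l ∈ Icc (0 : ℝ) 1, Tendsto k atTop (𝓝 l) ∧ φ l = l := by
  have hba : IsBoundedUnder (· ≤ ·) atTop k := isBoundedUnder_of ⟨1, fun n => (hk n).2⟩
  have hbb : IsBoundedUnder (· ≥ ·) atTop k := isBoundedUnder_of ⟨0, fun n => (hk n).1⟩
  -- A continuous antitone extension of `φ` to the whole line, since `l - ε` may be negative.
  set ψ : ℝ → ℝ := fun x => φ (max 0 x) with hψ
  have hψc : Continuous ψ :=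
    hcont.comp_continuous (by fun_prop) fun x => le_max_left 0 x
  have hψa : Antitone ψ := fun a b hab =>
    hanti (le_max_left 0 a) (le_max_left 0 b) (max_le_max_left 0 hab)
  have hψφ : ∀ x, 0 ≤ x → ψ x = φ x := fun x hx => by simp [hψ, max_eq_right hx]
  set l := liminf k atTop with hl
  set L := limsup k atTop with hL
  have hlL : l ≤ L := liminf_le_limsup hba hbb
  have hl0 : 0 ≤ l := le_liminf_of_le hba.isCoboundedUnder_ge (.of_forall fun n => (hk n).1)
  have hL1 : L ≤ 1 := limsup_le_of_le hbb.isCoboundedUnder_le (.of_forall fun n => (hk n).2)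
  have key : Tendsto (fun ε : ℝ => ψ (l - ε) + ε) (𝓝[>] 0) (𝓝 (ψ l)) ∧
      Tendsto (fun ε : ℝ => ψ (L + ε) - ε) (𝓝[>] 0) (𝓝 (ψ L)) := by
    constructor
    · have : Continuous (fun ε : ℝ => ψ (l - ε) + ε) := by fun_prop
      simpa using (this.tendsto 0).mono_left nhdsWithin_le_nhds
    · have : Continuous (fun ε : ℝ => ψ (L + ε) - ε) := by fun_prop
      simpa using (this.tendsto 0).mono_left nhdsWithin_le_nhds
  have hup : L ≤ ψ l := by
    refine ge_of_tendsto key.1 ?_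
    filter_upwards [self_mem_nhdsWithin] with ε hε
    rw [mem_Ioi] at hε
    refine limsup_le_of_le hbb.isCoboundedUnder_le ?_
    have h1 : ∀ᶠ n in atTop, l - ε < k n := eventually_lt_of_lt_liminf (by linarith) hbb
    have h2 : ∀ᶠ n in atTop, k (n + 1) - φ (k n) < ε := hlim.eventually (gt_mem_nhds hε)
    have h3 : ∀ᶠ n in atTop, k (n + 1) ≤ ψ (l - ε) + ε := by
      filter_upwards [h1, h2] with n h1 h2
      have := hψa h1.le
      rw [hψφ _ (hk n).1] at this
      linarith
    rw [← map_add_atTop_eq_nat 1, eventually_map]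
    exact h3
  have hlo : ψ L ≤ l := by
    refine le_of_tendsto key.2 ?_
    filter_upwards [self_mem_nhdsWithin] with ε hε
    rw [mem_Ioi] at hε
    refine le_liminf_of_le hba.isCoboundedUnder_ge ?_
    have h1 : ∀ᶠ n in atTop, k n < L + ε := eventually_lt_of_limsup_lt (by linarith) hba
    have h2 : ∀ᶠ n in atTop, -ε < k (n + 1) - φ (k n) :=
      hlim.eventually (lt_mem_nhds (by linarith))
    have h3 : ∀ᶠ n in atTop, ψ (L + ε) - ε ≤ k (n + 1) := by
      filter_upwards [h1, h2] with n h1 h2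
      have := hψa h1.le
      rw [hψφ _ (hk n).1] at this
      linarith
    rw [← map_add_atTop_eq_nat 1, eventually_map]
    exact h3
  rw [hψφ l hl0] at hup
  rw [hψφ L (hl0.trans hlL)] at hlo
  -- From `L ≤ φ l` and `φ L ≤ l` follows `L * φ L ≤ l * L ≤ l * φ l`, which contradicts strict
  -- monotonicity if `l < L`.
  have hEq : l = L := by
    by_contra hne
    have hlt := lt_of_le_of_ne hlL hne
    have h1 := hmono (mem_Ici.2 hl0) (mem_Ici.2 (hl0.trans hlL)) hlt
    simp only at h1
    nlinarith [mul_le_mul_of_nonneg_left hup hl0, mul_le_mul_of_nonneg_left hlo (hl0.trans hlL)]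
  refine ⟨l, ⟨hl0, hlL.trans hL1⟩, ?_, ?_⟩
  · exact tendsto_of_liminf_eq_limsup rfl hEq.symm hba hbb
  · rw [← hEq] at hup hlo
    exact le_antisymm hlo hup

/-! ### Behaviour of `f` near the multiple root -/

lemma contDiffAt_deriv {g : ℝ → ℝ} {n : ℕ} {x : ℝ} (hg : ContDiffAt ℝ (n + 1 : ℕ) g x) :
    ContDiffAt ℝ n (deriv g) x :=
  (hg.fderiv_right (m := (n : WithTop ℕ∞)) (by norm_cast)).clm_apply contDiffAt_const

lemma tendsto_div_pow_of_iteratedDeriv_eq_zero (n : ℕ) : ∀ (g : ℝ → ℝ), ContDiffAt ℝ n g 0 →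
    (∀ j < n, iteratedDeriv j g 0 = 0) →
    Tendsto (fun x => g x / x ^ n) (𝓝[>] 0) (𝓝 (iteratedDeriv n g 0 / n.factorial)) := by
  induction n with
  | zero =>
    intro g hg _
    simpa using hg.continuousAt.tendsto.mono_left nhdsWithin_le_nhds
  | succ n ih =>
    intro g hg h0
    have hd : ContDiffAt ℝ n (deriv g) 0 := contDiffAt_deriv hg
    have h1 := ih (deriv g) hd fun j hj => by
      rw [← iteratedDeriv_succ']; exact h0 _ (by omega)
    have hdiff : ∀ᶠ x in 𝓝[>] (0 : ℝ), DifferentiableAt ℝ g x := by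
      have h2 : ContDiffAt ℝ 1 g 0 := hg.of_le (by exact_mod_cast Nat.le_add_left 1 n)
      have := (h2.eventually (by simp)).mono fun x hx => hx.differentiableAt (by simp)
      exact nhdsWithin_le_nhds this
    have hg0 : g 0 = 0 := by simpa using h0 0 (by omega)
    refine deriv.lhopital_zero_nhdsGT hdiff ?_ ?_ ?_ ?_
    · filter_upwards [self_mem_nhdsWithin] with x hx
      have : (0 : ℝ) < x := hx
      rw [deriv_pow_field]; simp only [Nat.add_sub_cancel]; positivity
    · have := hg.continuousAt.tendsto.mono_left (nhdsWithin_le_nhds (s := Ioi 0))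
      rwa [hg0] at this
    · have : Continuous fun x : ℝ => x ^ (n + 1) := by fun_prop
      simpa using (this.tendsto 0).mono_left (nhdsWithin_le_nhds (s := Ioi 0))
    · have := h1.div_const (n + 1 : ℝ)
      rw [← iteratedDeriv_succ'] at this
      convert this using 1
      · ext x; rw [deriv_pow_field, div_div]; simp [mul_comm]
      · congr 1; push_cast [Nat.factorial_succ]; field_simp

/-- Cauchy's mean value theorem turns the increment ratio into the derivative ratio at a point
between `a` and `b`, so the bound is uniform in `b / a`. -/
lemma exists_increment_ratio_mem {g g' : ℝ → ℝ} {n : ℕ} (hn : 1 ≤ n) {A : ℝ}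
    (hg : ∀ᶠ x in 𝓝[>] 0, HasDerivAt g (g' x) x)
    (hlim : Tendsto (fun x => g' x / (n * x ^ (n - 1))) (𝓝[>] 0) (𝓝 A)) {U : Set ℝ}
    (hU : U ∈ 𝓝 A) :
    ∃ η > 0, ∀ a ∈ Ioo 0 η, ∀ b ∈ Ioo 0 η, a ≠ b → (g a - g b) / (a ^ n - b ^ n) ∈ U := by
  obtain ⟨η, hη, h⟩ := mem_nhdsGT_iff_exists_Ioo_subset.1 (hg.and (hlim hU))
  have main : ∀ a b, 0 < a → a < b → b < η → (g b - g a) / (b ^ n - a ^ n) ∈ U := by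
    intro a b ha hab hb
    have hsub : ∀ x ∈ Icc a b, x ∈ Ioo 0 η := fun x hx =>
      ⟨ha.trans_le hx.1, hx.2.trans_lt hb⟩
    obtain ⟨c, hc, hc'⟩ := exists_ratio_hasDerivAt_eq_ratio_slope g g' hab
      (fun x hx => (h (hsub x hx)).1.continuousAt.continuousWithinAt)
      (fun x hx => (h (hsub x (Ioo_subset_Icc_self hx))).1)
      (fun x => x ^ n) (fun x => n * x ^ (n - 1)) (by fun_prop)
      (fun x _ => hasDerivAt_pow n x)
    have hcη := h (hsub c (Ioo_subset_Icc_self hc))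
    have hc0 : 0 < c := ha.trans hc.1
    have hpow : a ^ n < b ^ n := pow_lt_pow_left₀ hab ha.le (by omega)
    have hn0 : (0 : ℝ) < n := by exact_mod_cast hn
    have : (g b - g a) / (b ^ n - a ^ n) = g' c / (n * c ^ (n - 1)) := by
      rw [div_eq_div_iff (sub_pos.2 hpow).ne' (by positivity)]
      linarith
    rw [this]
    exact hcη.2
  refine ⟨η, hη, fun a ha b hb hab => ?_⟩
  rcases lt_or_gt_of_ne hab with hlt | hlt
  · rw [← neg_sub, ← neg_sub (b ^ n), neg_div_neg_eq]
    exact main a b ha.1 hlt hb.2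
  · exact main b a hb.1 hlt ha.2

/-- The three asymptotic facts on `f` used for the secant iteration. -/
lemma multipleRoot_asymptotics {n : ℕ} (hn : 1 ≤ n) {f : ℝ → ℝ} (hf : ContDiffAt ℝ (n + 1 : ℕ) f 0)
    (hroot : IsMultipleRoot f 0 (n + 1)) :
    ∃ A : ℝ, A ≠ 0 ∧ Tendsto (fun x => f x / x ^ (n + 1)) (𝓝[>] 0) (𝓝 A) ∧
      (∀ U ∈ 𝓝 A, ∃ η > 0, ∀ a ∈ Ioo 0 η, ∀ b ∈ Ioo 0 η, a ≠ b →
        (f a - f b) / (a ^ (n + 1) - b ^ (n + 1)) ∈ U) ∧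
      (∀ U ∈ 𝓝 A, ∃ η > 0, ∀ a ∈ Ioo 0 η, ∀ b ∈ Ioo 0 η, a ≠ b →
        (f a / a - f b / b) / (a ^ n - b ^ n) ∈ U) := by
  have hlim := tendsto_div_pow_of_iteratedDeriv_eq_zero (n + 1) f hf hroot.1
  set A := iteratedDeriv (n + 1) f 0 / (n + 1).factorial with hA
  have hd : ContDiffAt ℝ n (deriv f) 0 := contDiffAt_deriv hf
  have hlim' := tendsto_div_pow_of_iteratedDeriv_eq_zero n (deriv f) hd fun j hj => by
    rw [← iteratedDeriv_succ']; exact hroot.1 _ (by omega)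
  rw [← iteratedDeriv_succ'] at hlim'
  have hA' : iteratedDeriv (n + 1) f 0 / n.factorial = (n + 1) * A := by
    rw [hA]; push_cast [Nat.factorial_succ]; field_simp
  rw [hA'] at hlim'
  have hdiff : ∀ᶠ x in 𝓝[>] (0 : ℝ), HasDerivAt f (deriv f x) x := by
    have h2 : ContDiffAt ℝ 1 f 0 := hf.of_le (by exact_mod_cast Nat.le_add_left 1 n)
    exact nhdsWithin_le_nhds ((h2.eventually (by simp)).mono fun x hx =>
      (hx.differentiableAt (by simp)).hasDerivAt)
  refine ⟨A, div_ne_zero hroot.2 (by positivity), hlim, fun U hU => ?_, fun U hU => ?_⟩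
  · refine exists_increment_ratio_mem (by omega) hdiff ?_ hU
    have := hlim'.div_const (n + 1 : ℝ)
    rw [mul_div_cancel_left₀ _ (by positivity)] at this
    convert this using 2
    push_cast
    rw [div_div, mul_comm]
  · refine exists_increment_ratio_mem (g := fun x => f x / x)
      (g' := fun x => (deriv f x * x - f x * 1) / x ^ 2) hn ?_ ?_ hU
    · filter_upwards [hdiff, self_mem_nhdsWithin] with x hx hx0
      exact hx.div (hasDerivAt_id x) (ne_of_gt hx0)
    · have hn0 : (0 : ℝ) < n := by exact_mod_cast hn
      have := (hlim'.sub hlim).div_const (n : ℝ)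
      -- The derivative of `f x / x`, divided by `n * x ^ (n - 1)`, is `(f' x / x ^ n - f x / x ^ (n
      -- + 1)) / n`.
      rw [show ((n + 1) * A - A) / n = A by field_simp; ring] at this
      refine this.congr' ?_
      filter_upwards [self_mem_nhdsWithin] with x hx
      have hx0 : (0 : ℝ) < x := hx
      obtain ⟨p, rfl⟩ := Nat.exists_eq_add_of_le' hn
      simp only [Nat.add_sub_cancel]
      field_simp
      ring

/-! ### One secant step -/

lemma secantRatioMap_div {n : ℕ} {a b : ℝ} (ha : 0 < a) (hb : 0 < b) (hab : a ≠ b) :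
    secantRatioMap n (b / a) = a * (a ^ n - b ^ n) / (a ^ (n + 1) - b ^ (n + 1)) := by
  have hk : b / a ≠ 1 := fun h => hab ((div_eq_one_iff_eq ha.ne').1 h).symm
  have hP : a ^ (n + 1) - b ^ (n + 1) ≠ 0 := fun h =>
    hab ((pow_left_inj₀ ha.le hb.le (by omega)).1 (sub_eq_zero.1 h))
  have h1 : (b / a - 1) ≠ 0 := sub_ne_zero.2 hk
  rw [secantRatioMap, geom_sum_eq hk, geom_sum_eq hk, div_div_div_cancel_right₀ h1, div_pow,
    div_pow, div_sub_one (by positivity), div_sub_one (by positivity), ← neg_sub (a ^ n),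
    ← neg_sub (a ^ (n + 1)), neg_div (a ^ n), neg_div (a ^ (n + 1)), neg_div_neg_eq]
  field_simp
  ring

/-- The step equals `a * b * (f a / a - f b / b) / (f a - f b)`; comparing each increment with that
of the pure power isolates `φ`. -/
lemma secant_step_eq {n : ℕ} (hn : 1 ≤ n) {f : ℝ → ℝ} {a b : ℝ} (ha : 0 < a) (hb : 0 < b)
    (hab : a ≠ b) (hfab : f a ≠ f b) :
    b - f b * ((a - b) / (f a - f b)) =
      ((f a / a - f b / b) / (a ^ n - b ^ n)) / ((f a - f b) / (a ^ (n + 1) - b ^ (n + 1))) *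
        secantRatioMap n (b / a) * b := by
  have hP : a ^ (n + 1) - b ^ (n + 1) ≠ 0 := fun h =>
    hab ((pow_left_inj₀ ha.le hb.le (by omega)).1 (sub_eq_zero.1 h))
  have hQ : a ^ n - b ^ n ≠ 0 := fun h =>
    hab ((pow_left_inj₀ ha.le hb.le (by omega)).1 (sub_eq_zero.1 h))
  have hF : f a - f b ≠ 0 := sub_ne_zero.2 hfab
  rw [secantRatioMap_div ha hb hab]
  generalize a ^ (n + 1) - b ^ (n + 1) = P at *
  generalize a ^ n - b ^ n = Q at *
  field_simp
  ring

lemma secant_step_symm {f : ℝ → ℝ} {a b : ℝ} (hfab : f a ≠ f b) :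
    b - f b * ((a - b) / (f a - f b)) = a - f a * ((b - a) / (f b - f a)) := by
  have hF : f a - f b ≠ 0 := sub_ne_zero.2 hfab
  have hF' : f b - f a ≠ 0 := sub_ne_zero.2 hfab.symm
  rw [← neg_sub (f a) (f b)] at *
  rw [← neg_sub a b, neg_div_neg_eq]
  field_simp
  ring

lemma sub_div_pow_sub_pow_pos {a b : ℝ} {m : ℕ} (hm : m ≠ 0) (ha : 0 < a) (hb : 0 < b)
    (hab : a ≠ b) : 0 < (a - b) / (a ^ m - b ^ m) := by
  rcases lt_or_gt_of_ne hab with h | h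
  · exact div_pos_of_neg_of_neg (sub_neg.2 h) (sub_neg.2 (pow_lt_pow_left₀ h ha.le hm))
  · exact div_pos (sub_pos.2 h) (sub_pos.2 (pow_lt_pow_left₀ h hb.le hm))

/-- One secant step near a root of multiplicity `n + 1`, uniformly in the ratio of the two
arguments. -/
lemma exists_secant_step {n : ℕ} (hn : 1 ≤ n) {f : ℝ → ℝ} (hf : ContDiffAt ℝ (n + 1 : ℕ) f 0)
    (hroot : IsMultipleRoot f 0 (n + 1)) {ε : ℝ} (hε : 0 < ε) :
    ∃ η > 0, ∀ a ∈ Ioo 0 η, ∀ b ∈ Ioo 0 η, a ≠ b → f a ≠ f b ∧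
      b - f b * ((a - b) / (f a - f b)) ∈ Ioo 0 (min a b) ∧
      ∃ ρ, |ρ - 1| < ε ∧ b - f b * ((a - b) / (f a - f b)) = ρ * secantRatioMap n (b / a) * b := by
  obtain ⟨A, hA, hlim, hfinc, hhinc⟩ := multipleRoot_asymptotics hn hf hroot
  have hcont : Tendsto (fun p : ℝ × ℝ => |p.1 / p.2 - 1|) (𝓝 A ×ˢ 𝓝 A) (𝓝 0) := by
    have : ContinuousAt (fun p : ℝ × ℝ => |p.1 / p.2 - 1|) (A, A) :=
      ((continuousAt_fst.div continuousAt_snd hA).sub continuousAt_const).abs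
    rw [← nhds_prod_eq]
    simpa [ContinuousAt, hA] using this
  -- The cap at 1 makes quotients of elements of `U` positive as well as close to 1.
  obtain ⟨U, hU, hUε⟩ := mem_prod_self_iff.1
    (hcont.eventually (gt_mem_nhds (lt_min hε zero_lt_one)))
  have hratio : ∀ x ∈ U, ∀ y ∈ U, |x / y - 1| < ε ∧ 0 < x / y := by
    intro x hx y hy
    have h := lt_min_iff.1 (show |x / y - 1| < min ε 1 from hUε (mk_mem_prod hx hy))
    exact ⟨h.1, by linarith [(abs_lt.1 h.2).1]⟩
  obtain ⟨η₁, hη₁, h₁⟩ := mem_nhdsGT_iff_exists_Ioo_subset.1 (hlim hU)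
  obtain ⟨η₂, hη₂, h₂⟩ := hfinc U hU
  obtain ⟨η₃, hη₃, h₃⟩ := hhinc U hU
  have hm0 : n + 1 ≠ 0 := by omega
  have hne : ∀ a ∈ Ioo 0 η₂, ∀ b ∈ Ioo 0 η₂, a ≠ b → f a ≠ f b := by
    intro a ha b hb hab hfab
    have := (hratio _ (h₂ a ha b hb hab) _ (h₂ a ha b hb hab)).2
    simp [hfab] at this
  have hlt : ∀ a ∈ Ioo 0 η₂, ∀ b ∈ Ioo 0 η₂, a ≠ b → b ∈ Ioo 0 η₁ →
      b - f b * ((a - b) / (f a - f b)) < b := by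
    intro a ha b hb hab hb'
    have h4 := (hratio _ (h₁ hb') _ (h₂ a ha b hb hab)).2
    have h5 := sub_div_pow_sub_pow_pos hm0 ha.1 hb.1 hab
    have hP : a ^ (n + 1) - b ^ (n + 1) ≠ 0 := fun h => by simp [h] at h5
    have hF : f a - f b ≠ 0 := sub_ne_zero.2 (hne a ha b hb hab)
    have hb0 : b ≠ 0 := hb.1.ne'
    have : f b * ((a - b) / (f a - f b)) =
        f b / b ^ (n + 1) / ((f a - f b) / (a ^ (n + 1) - b ^ (n + 1))) *
          (b ^ (n + 1) * ((a - b) / (a ^ (n + 1) - b ^ (n + 1)))) := by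
      generalize a ^ (n + 1) - b ^ (n + 1) = P at *
      field_simp
    rw [this]
    have := mul_pos h4 (mul_pos (pow_pos hb.1 (n + 1)) h5)
    linarith
  refine ⟨min η₁ (min η₂ η₃), lt_min hη₁ (lt_min hη₂ hη₃), fun a ha b hb hab => ?_⟩
  have hIoo : ∀ x ∈ Ioo 0 (min η₁ (min η₂ η₃)), x ∈ Ioo 0 η₁ ∧ x ∈ Ioo 0 η₂ ∧ x ∈ Ioo 0 η₃ := by
    intro x hx
    obtain ⟨h1, h2⟩ := lt_min_iff.1 hx.2
    obtain ⟨h2, h3⟩ := lt_min_iff.1 h2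
    exact ⟨⟨hx.1, h1⟩, ⟨hx.1, h2⟩, ⟨hx.1, h3⟩⟩
  obtain ⟨ha1, ha2, ha3⟩ := hIoo a ha
  obtain ⟨hb1, hb2, hb3⟩ := hIoo b hb
  have hfab := hne a ha2 b hb2 hab
  have hρ := hratio _ (h₃ a ha3 b hb3 hab) _ (h₂ a ha2 b hb2 hab)
  have heq := secant_step_eq hn ha.1 hb.1 hab hfab
  refine ⟨hfab, ⟨?_, lt_min ?_ (hlt a ha2 b hb2 hab hb1)⟩, _, hρ.1, heq⟩
  · rw [heq]
    exact mul_pos (mul_pos hρ.2 (secantRatioMap_pos hn (div_pos hb.1 ha.1).le)) hb.1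
  -- The secant step is symmetric in its two points, so the bound by `b` also yields the bound by
  -- `a`.
  · rw [secant_step_symm hfab]
    exact hlt b hb2 a ha2 hab.symm ha1

/-! ### The main theorem -/

theorem theorem4p6 (m : ℕ) (hm : 2 ≤ m) :
    ∃ c : ℝ, IsUniqueCharRoot m c ∧
      ∀ (δ : ℝ) (_ : 0 < δ) (f : ℝ → ℝ)
        (_ : ContDiffOn ℝ ((m + 1 : ℕ) : WithTop ℕ∞) f (Icc (-δ) δ))
        (_ : IsMultipleRoot f 0 m),
        ∃ η : ℝ, 0 < η ∧
          ∀ k₀ ∈ Ioo (0 : ℝ) 1 ∪ Ioi 1, ∀ e₀ : ℝ, 0 < e₀ → max e₀ (k₀ * e₀) < η →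
            (∀ n, secantSeq f e₀ (k₀ * e₀) n ∈ Ioc 0 δ) ∧
            (∀ n, f (secantSeq f e₀ (k₀ * e₀) n) ≠ f (secantSeq f e₀ (k₀ * e₀) (n + 1))) ∧
            ConvergesQLinearly (secantSeq f e₀ (k₀ * e₀)) 0 c ∧
            Tendsto (fun n => secantSeq f e₀ (k₀ * e₀) (n + 1) / secantSeq f e₀ (k₀ * e₀) n)
              atTop (𝓝 c) := by
  obtain ⟨c, hc⟩ := exists_isUniqueCharRoot hm
  refine ⟨c, hc, fun δ hδ f hf hroot => ?_⟩
  obtain ⟨n, rfl⟩ := Nat.exists_eq_add_of_le' (one_le_two.trans hm)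
  have hn : 1 ≤ n := by omega
  have hf0 : ContDiffAt ℝ (n + 1 : ℕ) f 0 :=
    (hf.contDiffAt (Icc_mem_nhds (by linarith) hδ)).of_le (by exact_mod_cast Nat.le_succ _)
  have hstep := fun {ε : ℝ} => exists_secant_step hn hf0 hroot (ε := ε)
  -- This tolerance keeps `(1 + ε) * φ 1 < 1`, where `φ 1 = n / (n + 1)`.
  obtain ⟨η, hη, hstepη⟩ := hstep (ε := 1 / (n + 1)) (by positivity)
  refine ⟨min η δ, lt_min hη hδ, fun k₀ hk₀ e₀ he₀ hmax => ?_⟩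
  set e := secantSeq f e₀ (k₀ * e₀) with he
  have hrec : ∀ j, e (j + 2) = e (j + 1) - f (e (j + 1)) * ((e j - e (j + 1)) /
      (f (e j) - f (e (j + 1)))) := fun j => by rw [he, secantSeq]
  have hk₀pos : 0 < k₀ := hk₀.elim (·.1) (zero_lt_one.trans ·)
  have hk₀ne : k₀ ≠ 1 := hk₀.elim (·.2.ne) (ne_of_gt ·)
  obtain ⟨hmax0, hmax1⟩ := max_lt_iff.1 hmax
  have hinv : ∀ j, e j ∈ Ioo 0 (min η δ) ∧ e (j + 1) ∈ Ioo 0 (min η δ) ∧ e j ≠ e (j + 1) := by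
    intro j
    induction j with
    | zero =>
      refine ⟨⟨he₀, hmax0⟩, ⟨mul_pos hk₀pos he₀, hmax1⟩, fun h => hk₀ne ?_⟩
      have h' : e₀ = k₀ * e₀ := h
      exact mul_right_cancel₀ he₀.ne' (by linarith)
    | succ j ih =>
      obtain ⟨h1, h2, h3⟩ := ih
      have := (hstepη _ ⟨h1.1, (lt_min_iff.1 h1.2).1⟩ _ ⟨h2.1, (lt_min_iff.1 h2.2).1⟩ h3).2.1
      rw [← hrec] at this
      have hlt := (lt_min_iff.1 this.2).2
      exact ⟨h2, ⟨this.1, hlt.trans h2.2⟩, hlt.ne'⟩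
  have hpos : ∀ j, 0 < e j := fun j => (hinv j).1.1
  have heη : ∀ j, e j ∈ Ioo 0 η := fun j => ⟨hpos j, (lt_min_iff.1 (hinv j).1.2).1⟩
  have hS := fun j => hstepη _ (heη j) _ (heη (j + 1)) (hinv j).2.2
  simp only [← hrec] at hS
  have hdec : ∀ j, e (j + 2) < e (j + 1) := fun j => (lt_min_iff.1 (hS j).2.1.2).2
  -- The shift drops the initial ratio `k₀`, which may exceed 1.
  set k : ℕ → ℝ := fun j => e (j + 2) / e (j + 1) with hk
  have hk01 : ∀ j, k j ∈ Icc (0 : ℝ) 1 := fun j =>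
    ⟨(div_pos (hpos _) (hpos _)).le, (div_le_one (hpos _)).2 (hdec j).le⟩
  have he0 : Tendsto e atTop (𝓝 0) := by
    have hanti : Antitone fun j => e (j + 1) := antitone_nat_of_succ_le fun j => (hdec j).le
    have hL := tendsto_atTop_ciInf hanti ⟨0, by rintro _ ⟨j, rfl⟩; exact (hpos _).le⟩
    set L := ⨅ j, e (j + 1)
    have hL0 : 0 ≤ L := ge_of_tendsto' hL fun j => (hpos _).le
    rcases hL0.eq_or_lt with h0 | h0
    · rw [← h0] at hL
      exact (tendsto_add_atTop_iff_nat 1).1 hL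
    -- A positive limit forces the ratios to 1, and the recursion then gives `1 ≤ (1 + ε) * φ 1`.
    · exfalso
      have hL2 : Tendsto (fun j => e (j + 2)) atTop (𝓝 L) :=
        (tendsto_add_atTop_iff_nat (f := fun j => e (j + 1)) 1).2 hL
      have hk1 : Tendsto k atTop (𝓝 1) := by
        have := hL2.div hL h0.ne'
        rwa [div_self h0.ne'] at this
      have hφ : Tendsto (fun j => secantRatioMap n (k j)) atTop (𝓝 (n / (n + 1))) := by
        rw [← secantRatioMap_one]
        exact ((continuousOn_secantRatioMap n).continuousAt
          (Ici_mem_nhds zero_lt_one)).tendsto.comp hk1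
      have hle : (1 : ℝ) ≤ (1 + 1 / (n + 1)) * (n / (n + 1)) := by
        refine le_of_tendsto_of_tendsto' ((tendsto_add_atTop_iff_nat 1).2 hk1)
          (hφ.const_mul _) fun j => ?_
        obtain ⟨ρ, hρ, h⟩ := (hS (j + 1)).2.2
        have h' : k (j + 1) = ρ * secantRatioMap n (k j) := by
          simp only [hk]
          rw [div_eq_iff (hpos _).ne']
          exact h
        rw [h']
        have := (abs_lt.1 hρ).2
        exact mul_le_mul_of_nonneg_right (by linarith) (secantRatioMap_nonneg n (hk01 j).1)
      have hn1 : (0 : ℝ) < n + 1 := by positivity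
      rw [show (1 + 1 / ((n : ℝ) + 1)) * (n / (n + 1)) = 1 - 1 / (n + 1) ^ 2 by
        field_simp; ring] at hle
      have : 0 < 1 / ((n : ℝ) + 1) ^ 2 := by positivity
      linarith
  have hasym : Tendsto (fun j => k (j + 1) - secantRatioMap n (k j)) atTop (𝓝 0) := by
    rw [Metric.tendsto_atTop']
    intro ε hε
    obtain ⟨η', hη', hstepη'⟩ := hstep hε
    obtain ⟨N, hN⟩ := eventually_atTop.1 (he0.eventually (gt_mem_nhds hη'))
    refine ⟨N, fun j hj => ?_⟩
    obtain ⟨ρ, hρ, h⟩ := (hstepη' (e (j + 1)) ⟨hpos _, hN _ (by omega)⟩ (e (j + 1 + 1))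
      ⟨hpos _, hN _ (by omega)⟩ (hinv _).2.2).2.2
    rw [← hrec] at h
    have h' : k (j + 1) = ρ * secantRatioMap n (k j) := by
      simp only [hk]
      rw [div_eq_iff (hpos _).ne']
      exact h
    rw [Real.dist_eq, sub_zero, h', ← sub_one_mul, abs_mul,
      abs_of_nonneg (secantRatioMap_nonneg n (hk01 j).1)]
    exact (mul_le_of_le_one_right (abs_nonneg _) (secantRatioMap_le_one n (hk01 j).1)).trans_lt hρ
  obtain ⟨l, hl, hkl, hfix⟩ := exists_tendsto_of_asymptotic_orbit (antitoneOn_secantRatioMap n)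
    (continuousOn_secantRatioMap n) (strictMonoOn_mul_secantRatioMap hn) hk01 hasym
  obtain ⟨hl1, hl2⟩ := charRoot_of_fixedPoint hn hl hfix
  obtain rfl : l = c := hc.2 l hl1 hl2
  have hratio : Tendsto (fun j => e (j + 1) / e j) atTop (𝓝 l) :=
    (tendsto_add_atTop_iff_nat (f := fun j => e (j + 1) / e j) 1).1 hkl
  refine ⟨fun j => ⟨hpos j, (lt_min_iff.1 (hinv j).1.2).2.le⟩, fun j => (hS j).1,
    ⟨⟨he0, le_rfl, hl1.1, hratio.congr fun j => ?_⟩, hl1.2⟩, hratio⟩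
  rw [sub_zero, sub_zero, Real.rpow_one, abs_of_pos (hpos _), abs_of_pos (hpos _)]
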